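/- Setting. Let $N\ge 1$ servers each store the same $M\ge 2$ files $W_1,\dots,W_M$; each file consists of $L=N^M$ symbols, all symbols being independent and uniform on a finite abelian group $\mathcal A$ with $|\mathcal A|\ge 2$. To retrieve file $W_\theta$, with $\theta$ uniform on $\{1,\dots,M\}$, the client sends random queries $Q_0,\dots,Q_{N-1}$, whose joint law depends only on $\theta$, to the servers; server $l$ returns an answer $A_l$ which is a function of $Q_l$ and of the files. The scheme is correct if, for every desired index, $H(W_\theta\mid A_0,\dots,A_{N-1},Q_0,\dots,Q_{N-1})=0$. Its rate is $R=L\log|\mathcal A|\,/\,\mathbb E[D]$, where $D$ is the total number of downloaded bits (a symbol of $\mathcal A$ counts $\log|\mathcal A|$ bits), and its maximal leakage is $$\rho^{\mathsf{MaxL}}=\max_{0\le l\le N-1}\log\Big(\sum_{q}\max_{1\le m\le M}\Pr(Q_l=q\mid\theta=m)\Big).$$ All logarithms are to base $2$. The scheme $\mathcal P_{\mathsf{WSJ}}$, with parameter a probability distribution $\mathsf P_{M'}$ on $\{0,\dots,M-1\}$: the client draws $M'\sim\mathsf P_{M'}$. If $M'=0$, it asks one uniformly random server for the whole desired file, and sends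 a null query, which gets an empty answer, to all other servers. If $M'=m'\neq 0$, it chooses $m'$ of the other $M-1$ files uniformly at random and runs the Sun–Jafar private information retrieval scheme with $N$ servers on these files and the desired one, where each of these $m'+1$ files is cut, in order, into $N^{m'+1}$ super-segments of $N^{M-m'-1}$ symbols. Theorem. For every $\rho\ge 0$ there is a distribution $\mathsf P_{M'}$ supported on $\{0,M-1\}$ (that is, clean download of the desired file from a random server is time-shared with the Sun–Jafar scheme on all $M$ files) for which $\mathcal P_{\mathsf{WSJ}}$ is correct and has $$\rho^{\mathsf{MaxL}}=\min\Big(\rho,\ \log\Big(1+\frac{M-1}{N}\Big)\Big),\qquad R=\Big(1+\Big(1-N\,\frac{2^{\rho}-1}{M-1}\Big)_+\Big(\frac1N+\cdots+\frac1{N^{M-1}}\Big)\Big)^{-1},$$ where $(x)_+=\max(x,0)$. -/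

import Mathlib

/-! ### Information-retrieval schemes with replicated servers -/

/-- Conditional Shannon entropy `H(X | Y)` in bits of two random variables on a finite
probability space: the expectation of `-log₂ P(X | Y)`. -/
noncomputable def condEntropy {Ω α β : Type*} [Fintype Ω] (P : PMF Ω)
    (X : Ω → α) (Y : Ω → β) : ℝ :=
  -∑ ω, (P ω).toReal * Real.logb 2
    ((P.toOuterMeasure {ω' | X ω' = X ω ∧ Y ω' = Y ω}).toReal /
      (P.toOuterMeasure {ω' | Y ω' = Y ω}).toReal)

/-- An information-retrieval scheme with `N` servers, each of which stores all `M` files; a file is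
a word of `L` symbols of the alphabet `A`. The client sends one query to each server; the joint
law of the queries depends on the index of the desired file only. An answer is a finite family
of symbols of `A`, a deterministic function of the query and of the stored files. -/
structure IRScheme (N M L : ℕ) (A : Type*) where
  /-- the set of queries that can be sent to server `l` -/
  Query : Fin N → Type
  queryFintype : ∀ l, Fintype (Query l)
  /-- the joint law of the queries when the desired file has index `m` -/
  queryLaw : Fin M → PMF (∀ l, Query l)
  /-- the positions of the answer of server `l` to a query -/
  AnswerIndex : ∀ l, Query l → Type
  answerFintype : ∀ l q, Fintype (AnswerIndex l q)
  /-- the answer of server `l` to a query, given the contents of all files -/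
  answer : ∀ l (q : Query l), (Fin M → Fin L → A) → AnswerIndex l q → A

attribute [instance] IRScheme.queryFintype IRScheme.answerFintype

namespace IRScheme

variable {N M L : ℕ} {A : Type*}

/-- Joint law of the queries and of the files when file `m` is desired. The symbols of the files
are independent and uniform on `A`, and independent of the queries. -/
noncomputable def jointLaw [Fintype A] [Nonempty A] (C : IRScheme N M L A) (m : Fin M) :
    PMF ((∀ l, C.Query l) × (Fin M → Fin L → A)) :=
  (C.queryLaw m).bind fun q =>
    (PMF.uniformOfFintype (Fin M → Fin L → A)).map fun W => (q, W)

/-- All queries together with all answers. -/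
def transcript (C : IRScheme N M L A) (x : (∀ l, C.Query l) × (Fin M → Fin L → A)) :
    Σ q : (∀ l, C.Query l), ∀ l, C.AnswerIndex l (q l) → A :=
  ⟨x.1, fun l => C.answer l (x.1 l) x.2⟩

/-- Correctness: whatever the index `m` of the desired file is, the conditional entropy of the
file `W_m` given all queries and all answers vanishes. -/
def Correct [Fintype A] [Nonempty A] (C : IRScheme N M L A) : Prop :=
  ∀ m : Fin M, condEntropy (C.jointLaw m) (fun x => x.2 m) C.transcript = 0

/-- The total number of downloaded bits for given queries: a symbol of `A` counts `log₂ |A|`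
bits. -/
noncomputable def download [Fintype A] (C : IRScheme N M L A) (q : ∀ l, C.Query l) : ℝ :=
  ∑ l, (Fintype.card (C.AnswerIndex l (q l)) : ℝ) * Real.logb 2 (Fintype.card A)

/-- The expected number of downloaded bits, for a uniformly distributed desired index. -/
noncomputable def expectedDownload [Fintype A] (C : IRScheme N M L A) : ℝ :=
  ∑ m : Fin M, (1 / (M : ℝ)) * ∑ q : (∀ l, C.Query l), (C.queryLaw m q).toReal * C.download q

/-- The rate: size of a file in bits over the expected number of downloaded bits. -/
noncomputable def rate [Fintype A] (C : IRScheme N M L A) : ℝ :=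
  (L * Real.logb 2 (Fintype.card A)) / C.expectedDownload

/-- The law of the query seen by server `l` when file `m` is desired. -/
noncomputable def serverLaw (C : IRScheme N M L A) (l : Fin N) (m : Fin M) : PMF (C.Query l) :=
  (C.queryLaw m).map fun q => q l

/-- The maximal-leakage privacy metric:
`max_l log₂ (∑_q max_m P(Q_l = q | θ = m))`. -/
noncomputable def maxLeakage (C : IRScheme N M L A) : ℝ :=
  ⨆ l : Fin N, Real.logb 2 (∑ q : C.Query l, ⨆ m : Fin M, (C.serverLaw l m q).toReal)

end IRScheme

/-! ### The queries of the Sun–Jafar scheme for `N` servers and `K` files of `N ^ K` segments -/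

/-- The sums that are requested from one server: for every nonempty set `T` of files there are
`(N - 1) ^ (|T| - 1)` sums of type `T`, that is, sums of one segment of each file in `T`.
These sums are labelled by the words of length `|T| - 1` over `Fin (N - 1)`. -/
abbrev SJSlot (N K : ℕ) : Type :=
  Σ T : {T : Finset (Fin K) // T.Nonempty}, (Fin (T.1.card - 1) → Fin (N - 1))

/-- A query to one server: for every requested sum and every file in its type, the index of the
segment of that file which enters the sum. -/
abbrev SJQuery (N K : ℕ) : Type :=
  ∀ s : SJSlot N K, {i : Fin K // i ∈ s.1.1} → Fin (N ^ K)

/-- The `a`-th server different from server `n`. -/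
def otherServer {N : ℕ} (n : Fin N) (a : Fin (N - 1)) : Fin N :=
  if a.val < n.val then ⟨a.val, by omega⟩ else ⟨a.val + 1, by omega⟩

/-- The new segment of file `i ∈ T` (before the random permutation) which is reserved for the
sum of type `T` with label `j` at server `n`. For fixed `i`, different triples `(n, T, j)` get
different segments: the index has `n` as its digit in base `N` at place `i`; at a place `r ≠ i` it
has the digit `0` if `r ∉ T`, and otherwise one plus the letter of `j` whose position is
the rank of `r` in `T \ {i}`. -/
def newSegment {N K : ℕ} (n : Fin N) (T : Finset (Fin K))
    (j : Fin (T.card - 1) → Fin (N - 1)) (i : Fin K) (hi : i ∈ T) : Fin (N ^ K) :=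
  finFunctionFinEquiv fun r =>
    if hr : r = i then n
    else if hT : r ∈ T then
      let a := j (((T.erase i).orderIsoOfFin (Finset.card_erase_of_mem hi)).symm
        ⟨r, Finset.mem_erase.2 ⟨hr, hT⟩⟩)
      ⟨a.val + 1, by omega⟩
    else ⟨0, n.pos⟩

/-- The segment of file `i` in a sum at server `n` when file `θ` is desired, before the random
permutation. A sum whose type does not contain `θ`, or equals `{θ}`, consists of new segments.
In a sum whose type `T` contains `θ` and other files, the segment of `θ` is new, and the
rest is a sum of type `T \ {θ}` requested from another server: the first letter of the label
says from which server, and the remaining letters are the label of that sum there. -/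
def sjSegment {N K : ℕ} (θ : Fin K) (n : Fin N) (s : SJSlot N K) (i : {i : Fin K // i ∈ s.1.1}) :
    Fin (N ^ K) :=
  if h : θ ∈ s.1.1 ∧ i.1 ≠ θ then
    have hc : (s.1.1.erase θ).card = s.1.1.card - 1 := Finset.card_erase_of_mem h.1
    have hi : i.1 ∈ s.1.1.erase θ := Finset.mem_erase.2 ⟨h.2, i.2⟩
    have hpos : 0 < (s.1.1.erase θ).card := Finset.card_pos.2 ⟨i.1, hi⟩
    newSegment (otherServer n (s.2 ⟨0, by omega⟩)) (s.1.1.erase θ)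
      (fun x => s.2 ⟨x.val + 1, by omega⟩) i.1 hi
  else newSegment n s.1.1 s.2 i.1 i.2

/-- The joint law of the queries of the Sun–Jafar scheme when file `θ` is desired: the segments
of the files are permuted by independent uniformly random permutations. -/
noncomputable def sjQueryLaw (N K : ℕ) (θ : Fin K) : PMF (Fin N → SJQuery N K) :=
  (PMF.uniformOfFintype (Fin K → Equiv.Perm (Fin (N ^ K)))).map
    fun γ n s i => γ i.1 (sjSegment θ n s i)

/-! ### The time-sharing scheme -/

/-- The queries of the time-sharing scheme: the null query, the request for the whole of file
`k`, and the queries of the Sun–Jafar scheme for the files in a set `S`. -/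
inductive WSJQuery (N M : ℕ) : Type
  | null : WSJQuery N M
  | file (k : Fin M) : WSJQuery N M
  | sj (S : Finset (Fin M)) (q : SJQuery N S.card) : WSJQuery N M

open Classical in
noncomputable instance (N M : ℕ) : Fintype (WSJQuery N M) :=
  Fintype.ofSurjective
    (fun x : Unit ⊕ Fin M ⊕ (Σ S : Finset (Fin M), SJQuery N S.card) =>
      match x with
      | .inl _ => WSJQuery.null
      | .inr (.inl k) => WSJQuery.file k
      | .inr (.inr y) => WSJQuery.sj y.1 y.2)
    (fun q => match q with
      | .null => ⟨.inl (), rfl⟩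
      | .file k => ⟨.inr (.inl k), rfl⟩
      | .sj S q => ⟨.inr (.inr ⟨S, q⟩), rfl⟩)

/-- The Sun–Jafar queries for the files in `S`, among which `k` is desired. The files in `S` are
numbered in increasing order. -/
noncomputable def sjQueryLawOn (N : ℕ) {M : ℕ} (S : Finset (Fin M)) (k : Fin M) (hk : k ∈ S) :
    PMF (Fin N → WSJQuery N M) :=
  (sjQueryLaw N S.card ((S.orderIsoOfFin rfl).symm ⟨k, hk⟩)).map fun q l => WSJQuery.sj S (q l)

lemma powersetCard_erase_nonempty {M : ℕ} (k m' : Fin M) :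
    (((Finset.univ : Finset (Fin M)).erase k).powersetCard m'.val).Nonempty := by
  apply Finset.powersetCard_nonempty_of_le
  rw [Finset.card_erase_of_mem (Finset.mem_univ k), Finset.card_univ, Fintype.card_fin]
  omega

/-- The queries when file `k` is desired and `m'` is the number of additional files: if `m' = 0`,
a uniformly random server is asked for file `k` and the others get the null query;
otherwise the Sun–Jafar queries for `k` and `m'` other files, chosen uniformly at random, are
sent. -/
noncomputable def wsjQueryLawGiven (N M : ℕ) [NeZero N] (k m' : Fin M) :
    PMF (Fin N → WSJQuery N M) :=
  if m'.val = 0 then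
    (PMF.uniformOfFintype (Fin N)).map fun s l => if l = s then WSJQuery.file k else WSJQuery.null
  else
    (PMF.uniformOfFinset _ (powersetCard_erase_nonempty k m')).bind fun J =>
      sjQueryLawOn N (insert k J) k (Finset.mem_insert_self k J)

/-- Level-`s` super-segments: the `N ^ M` segments of a file are grouped, in order, into `N ^ s`
super-segments of `N ^ (M - s)` segments each. This is super-segment number `x`. -/
def superSegment {N M s : ℕ} {A : Type*} (hs : s ≤ M) (w : Fin (N ^ M) → A) (x : Fin (N ^ s)) :
    Fin (N ^ (M - s)) → A :=
  fun y => w (Fin.cast (by rw [← pow_add, Nat.add_sub_cancel' hs]) (finProdFinEquiv (x, y)))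

/-- The positions of the answer to a query. -/
def WSJAnswerIndex {N M : ℕ} : WSJQuery N M → Type
  | .null => Empty
  | .file _ => Fin (N ^ M)
  | .sj S _ => SJSlot N S.card × Fin (N ^ (M - S.card))

instance {N M : ℕ} (q : WSJQuery N M) : Fintype (WSJAnswerIndex q) :=
  match q with
  | .null => inferInstanceAs (Fintype Empty)
  | .file _ => inferInstanceAs (Fintype (Fin (N ^ M)))
  | .sj S _ => inferInstanceAs (Fintype (SJSlot N S.card × Fin (N ^ (M - S.card))))

/-- The answer of a server: nothing, the whole file, or the requested sums of
super-segments. -/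
def wsjAnswer {N M : ℕ} {A : Type*} [AddCommGroup A] (W : Fin M → Fin (N ^ M) → A) :
    (q : WSJQuery N M) → WSJAnswerIndex q → A
  | .null => fun x => Empty.elim x
  | .file k => fun x => W k x
  | .sj S q => fun x =>
      ∑ i : {i : Fin S.card // i ∈ x.1.1.1},
        superSegment (card_finset_fin_le S) (W (S.orderEmbOfFin rfl i.1)) (q x.1 i) x.2

/-- The scheme `P_WSJ` for `N` servers and `M` files of `N ^ M` symbols each, where `p` is the
law of the number of additional files. -/
noncomputable def WSJ (N M : ℕ) [NeZero N] (A : Type*) [AddCommGroup A] (p : PMF (Fin M)) :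
    IRScheme N M (N ^ M) A where
  Query _ := WSJQuery N M
  queryFintype _ := inferInstance
  queryLaw k := p.bind (wsjQueryLawGiven N M k)
  AnswerIndex _ q := WSJAnswerIndex q
  answerFintype _ _ := inferInstance
  answer _ q W := wsjAnswer W q

/-! ### Finite probability -/

/-! Use clean download with probability `t` and the Sun–Jafar scheme on all files with probability
`1 - t`; leakage and expected download are then both explicit functions of `t`.

Leakage: by privacy (`sjQueryLaw_map_eval`) the Sun–Jafar part of a server's query law is the same
for every desired file, and so is the weight `t (1 - 1/N)` of the null query. Only the `M` requests
for a whole file depend on the desired index: each has weight `t/N` for one index and `0` for the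
others. Taking maxima therefore counts `t/N` a total of `M` times instead of once, and the sum is `1
+ t (M - 1)/N` (`sum_iSup_timeSharing`). Solving for `2 ^ ρ` and capping at `1` gives `t`.

Rate: every Sun–Jafar query asks for `∑_T (N - 1) ^ (|T| - 1) = 1 + N + ⋯ + N ^ (K - 1)` sums per
server (`card_SJSlot`), so the download is constant on each branch and its expectation is affine in
`t`.

Correctness holds for every law of the number of additional files. Each segment of the desired file
occurs as the new segment of some sum (`exists_newSegment_eq`), and the rest of that sum is
requested verbatim from another server (`sj_decode`). -/

lemma condEntropy_eq_zero {Ω α β : Type*} [Fintype Ω] (P : PMF Ω) (X : Ω → α) (Y : Ω → β)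
    (h : ∀ ω ∈ P.support, ∀ ω' ∈ P.support, Y ω' = Y ω → X ω' = X ω) :
    condEntropy P X Y = 0 := by
  unfold condEntropy
  rw [neg_eq_zero]
  refine Finset.sum_eq_zero fun ω _ => ?_
  by_cases hω : P ω = 0
  · simp [hω]
  have hs : P.toOuterMeasure {ω' | X ω' = X ω ∧ Y ω' = Y ω} =
      P.toOuterMeasure {ω' | Y ω' = Y ω} := by
    apply PMF.toOuterMeasure_apply_eq_of_inter_support_eq
    ext ω'
    simp only [Set.mem_inter_iff, Set.mem_ofPred_eq]
    exact ⟨fun h' => ⟨h'.1.2, h'.2⟩,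
      fun h' => ⟨⟨h ω ((P.mem_support_iff ω).2 hω) ω' h'.2 h'.1, h'.1⟩, h'.2⟩⟩
  rw [hs]
  -- The zero case needs no contradiction: `0 / 0 = 0` and `Real.logb 2 0 = 0`.
  rcases eq_or_ne (P.toOuterMeasure {ω' | Y ω' = Y ω}).toReal 0 with h0 | h0
  · rw [h0]; simp
  · rw [div_self h0]; simp

lemma PMF.sum_toReal {α : Type*} [Fintype α] (P : PMF α) : ∑ a, (P a).toReal = 1 := by
  rw [← ENNReal.toReal_sum fun a _ => P.apply_ne_top a, ← tsum_fintype (L := .unconditional _), P.tsum_coe,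
    ENNReal.toReal_one]

lemma PMF.sum_toReal_mul_of_const {α : Type*} [Fintype α] (P : PMF α) (f : α → ℝ) (c : ℝ)
    (h : ∀ a ∈ P.support, f a = c) : ∑ a, (P a).toReal * f a = c := by
  have : ∀ a, (P a).toReal * f a = (P a).toReal * c := fun a => by
    by_cases ha : P a = 0
    · simp [ha]
    · rw [h a ((P.mem_support_iff a).2 ha)]
  rw [Finset.sum_congr rfl fun a _ => this a, ← Finset.sum_mul, P.sum_toReal, one_mul]

lemma PMF.sum_toReal_mul_of_mixture {α : Type*} [Fintype α] {P P₁ P₂ : PMF α} {f : α → ℝ}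
    {t c₁ c₂ : ℝ} (hP : ∀ a, (P a).toReal = t * (P₁ a).toReal + (1 - t) * (P₂ a).toReal)
    (h₁ : ∀ a ∈ P₁.support, f a = c₁) (h₂ : ∀ a ∈ P₂.support, f a = c₂) :
    ∑ a, (P a).toReal * f a = t * c₁ + (1 - t) * c₂ := by
  simp only [hP, add_mul, mul_assoc, Finset.sum_add_distrib, ← Finset.mul_sum,
    P₁.sum_toReal_mul_of_const f c₁ h₁, P₂.sum_toReal_mul_of_const f c₂ h₂]

lemma PMF.bind_eq_of_const {α β : Type*} (P : PMF α) (f : α → PMF β) (Q : PMF β)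
    (h : ∀ a ∈ P.support, f a = Q) : P.bind f = Q := by
  ext b
  have : ∀ a, P a * f a b = P a * Q b := fun a => by
    by_cases ha : P a = 0
    · simp [ha]
    · rw [h a ((P.mem_support_iff a).2 ha)]
  rw [PMF.bind_apply, tsum_congr this, ENNReal.tsum_mul_right, P.tsum_coe, one_mul]

lemma PMF.map_equiv_uniformOfFintype {α : Type*} [Fintype α] [Nonempty α] (e : α ≃ α) :
    (PMF.uniformOfFintype α).map e = PMF.uniformOfFintype α := by
  classical
  ext b
  rw [PMF.map_apply, tsum_eq_single (e.symm b)]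
  · simp
  · intro a ha
    rw [if_neg]
    rintro rfl
    simp at ha

/-- The bijection `f a ↦ g a` between the two ranges extends to the finite type `β`, because the
complements have equal cardinality. For privacy it relabels the segments used for one desired file
into those used for another. -/
lemma Equiv.Perm.exists_comp_eq {α β : Type*} [Finite β] {f g : α → β}
    (hf : Function.Injective f) (hg : Function.Injective g) :
    ∃ σ : Equiv.Perm β, ∀ a, σ (f a) = g a := by
  classical
  have := Fintype.ofFinite β
  let e : {b // b ∈ Set.range f} ≃ {b // b ∈ Set.range g} :=
    (Equiv.ofInjective f hf).symm.trans (Equiv.ofInjective g hg)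
  refine ⟨e.extendSubtype, fun a => ?_⟩
  rw [e.extendSubtype_apply_of_mem (f a) ⟨a, rfl⟩]
  have : (Equiv.ofInjective f hf).symm ⟨f a, a, rfl⟩ = a := by
    rw [Equiv.symm_apply_eq]; rfl
  simp [e, this]

/-! ### The Sun–Jafar scheme -/

lemma otherServer_ne {N : ℕ} (n : Fin N) (a : Fin (N - 1)) : otherServer n a ≠ n := by
  unfold otherServer
  intro h
  split_ifs at h <;> simp only [Fin.ext_iff] at h <;> omega

lemma otherServer_injective {N : ℕ} (n : Fin N) : Function.Injective (otherServer n) := by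
  intro a b h
  unfold otherServer at h
  split_ifs at h <;> simp only [Fin.ext_iff] at h ⊢ <;> omega

lemma newSegment_injective {N K : ℕ} {n n' : Fin N} {s s' : SJSlot N K} {i : Fin K}
    (hi : i ∈ s.1.1) (hi' : i ∈ s'.1.1)
    (h : newSegment n s.1.1 s.2 i hi = newSegment n' s'.1.1 s'.2 i hi') : n = n' ∧ s = s' := by
  have h := finFunctionFinEquiv.injective h
  refine ⟨by simpa using congrFun h i, ?_⟩
  obtain ⟨⟨T, hT⟩, j⟩ := s
  obtain ⟨⟨T', hT'⟩, j'⟩ := s'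
  simp only at hi hi' h
  -- Away from place `i`, the nonzero digits sit exactly at the elements of the type, since letters
  -- are shifted by one.
  have hTT : T = T' := by
    ext r
    by_cases hr : r = i
    · simp [hr, hi, hi']
    have hr' := congrFun h r
    simp only [hr, dite_false] at hr'
    by_cases h1 : r ∈ T <;> by_cases h2 : r ∈ T' <;> simp_all [Fin.ext_iff]
  subst hTT
  congr 1
  funext x
  have hx := ((T.erase i).orderIsoOfFin (Finset.card_erase_of_mem hi) x).2
  have hr' := congrFun h ((T.erase i).orderIsoOfFin (Finset.card_erase_of_mem hi) x).1
  rw [Finset.mem_erase] at hx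
  rw [dif_neg hx.1, dif_pos hx.2, dif_neg hx.1, dif_pos hx.2] at hr'
  simp only [Subtype.coe_eta, OrderIso.symm_apply_apply, Fin.ext_iff] at hr'
  exact Fin.ext (by omega)

/-- Read the base-`N` digits backwards: the digit at `i` is the server, the places of the other
nonzero digits complete the type, and those digits minus one are the label. Hence the new segments
of a file exhaust the file. -/
lemma exists_newSegment_eq {N K : ℕ} (i : Fin K) (x : Fin (N ^ K)) :
    ∃ (n : Fin N) (s : SJSlot N K) (hi : i ∈ s.1.1), newSegment n s.1.1 s.2 i hi = x := by
  classical
  obtain ⟨d, rfl⟩ := finFunctionFinEquiv.surjective x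
  let T : Finset (Fin K) := insert i (Finset.univ.filter fun r => (d r).val ≠ 0)
  have hi : i ∈ T := Finset.mem_insert_self _ _
  have hd : ∀ x, (d ((T.erase i).orderIsoOfFin (Finset.card_erase_of_mem hi) x).1).val ≠ 0 := by
    intro x
    have hx := ((T.erase i).orderIsoOfFin (Finset.card_erase_of_mem hi) x).2
    simp only [T, Finset.mem_erase, Finset.mem_insert, Finset.mem_filter] at hx
    tauto
  refine ⟨d i, ⟨⟨T, i, hi⟩, fun x =>
    ⟨(d ((T.erase i).orderIsoOfFin (Finset.card_erase_of_mem hi) x).1).val - 1, ?_⟩⟩, hi, ?_⟩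
  · have := hd x
    omega
  · unfold newSegment
    congr 1
    funext r
    by_cases hr : r = i
    · simp [hr]
    by_cases hT : r ∈ T
    · have h0 : (d r).val ≠ 0 := by
        simpa [T, hr] using hT
      simp only [hr, hT, dite_true, dite_false, OrderIso.apply_symm_apply]
      exact Fin.ext (Nat.succ_pred_eq_of_ne_zero h0)
    · have h0 : (d r).val = 0 := by
        by_contra h0
        exact hT (Finset.mem_insert_of_mem (Finset.mem_filter.2 ⟨Finset.mem_univ _, h0⟩))
      simp only [hr, hT, dite_false]
      exact Fin.ext h0.symm

/-- The sum requested from another server that is contained in the sum `s` of a type containing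
the desired file `θ` and another file. -/
def sideSlot {N K : ℕ} (θ : Fin K) (s : SJSlot N K) (hθ : θ ∈ s.1.1)
    (hne : (s.1.1.erase θ).Nonempty) : SJSlot N K :=
  ⟨⟨s.1.1.erase θ, hne⟩, fun x => s.2 ⟨x.val + 1, by
    have := Finset.card_erase_of_mem hθ
    have := x.isLt
    simp only at this
    omega⟩⟩

/-- The first letter of the label of `s`, which names the server of `sideSlot`. -/
def sideLetter {N K : ℕ} (θ : Fin K) (s : SJSlot N K) (hθ : θ ∈ s.1.1)
    (hne : (s.1.1.erase θ).Nonempty) : Fin (N - 1) :=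
  s.2 ⟨0, by
    have := Finset.card_erase_of_mem hθ
    have := Finset.card_pos.2 hne
    omega⟩

lemma sjSegment_of_new {N K : ℕ} {θ : Fin K} {n : Fin N} {s : SJSlot N K}
    {i : {i : Fin K // i ∈ s.1.1}} (h : θ ∈ s.1.1 → i.1 = θ) :
    sjSegment θ n s i = newSegment n s.1.1 s.2 i.1 i.2 := by
  unfold sjSegment
  rw [dif_neg (by tauto)]

lemma sjSegment_of_side {N K : ℕ} {θ : Fin K} {n : Fin N} {s : SJSlot N K}
    {i : {i : Fin K // i ∈ s.1.1}} (hθ : θ ∈ s.1.1) (hi : i.1 ∈ s.1.1.erase θ) :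
    sjSegment θ n s i = newSegment (otherServer n (sideLetter θ s hθ ⟨i.1, hi⟩))
      (sideSlot θ s hθ ⟨i.1, hi⟩).1.1 (sideSlot θ s hθ ⟨i.1, hi⟩).2 i.1 hi := by
  unfold sjSegment
  rw [dif_pos ⟨hθ, (Finset.mem_erase.1 hi).1⟩]
  rfl

/-- The type is recovered by reinserting `θ`, and the label by putting the first letter back in
front of the remaining ones. -/
lemma side_injective {N K : ℕ} {θ : Fin K} {s s' : SJSlot N K} {hθ : θ ∈ s.1.1}
    {hθ' : θ ∈ s'.1.1} {hne : (s.1.1.erase θ).Nonempty} {hne' : (s'.1.1.erase θ).Nonempty}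
    (h : sideLetter θ s hθ hne = sideLetter θ s' hθ' hne')
    (hs : sideSlot θ s hθ hne = sideSlot θ s' hθ' hne') : s = s' := by
  obtain ⟨⟨T, hT⟩, j⟩ := s
  obtain ⟨⟨T', hT'⟩, j'⟩ := s'
  have hTT : T = T' := by
    have := congrArg (fun s : SJSlot N K => insert θ s.1.1) hs
    simpa [sideSlot, Finset.insert_erase hθ, Finset.insert_erase hθ'] using this
  subst hTT
  simp only [sideSlot, Sigma.mk.injEq, heq_eq_eq, true_and] at hs
  congr 1
  funext ⟨y, hy⟩
  rcases y with _ | y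
  · exact h
  · have hc := Finset.card_erase_of_mem hθ
    simp only at hc hy
    exact congrFun hs ⟨y, by omega⟩

/-- Every segment of a file enters at most one of the sums requested from a server. -/
lemma sjSegment_injective {N K : ℕ} (θ : Fin K) (n : Fin N) (i : Fin K) :
    Function.Injective fun s : {s : SJSlot N K // i ∈ s.1.1} => sjSegment θ n s.1 ⟨i, s.2⟩ := by
  rintro ⟨s, hs⟩ ⟨s', hs'⟩ h
  simp only [Subtype.mk.injEq] at h ⊢
  have key : ∀ s : SJSlot N K, i ∈ s.1.1 → (θ ∈ s.1.1 → i = θ) ∨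
      (θ ∈ s.1.1 ∧ i ∈ s.1.1.erase θ) := fun s hs => by
    rw [Finset.mem_erase]; tauto
  -- A segment new at server `n` cannot coincide with one reserved for a side sum, which belongs to
  -- a server other than `n`. Two side segments that agree come from the same server and side sum,
  -- hence from the same slot.
  rcases key s hs with h1 | ⟨h1, h1'⟩ <;> rcases key s' hs' with h2 | ⟨h2, h2'⟩
  · rw [sjSegment_of_new h1, sjSegment_of_new h2] at h
    exact (newSegment_injective _ _ h).2
  · rw [sjSegment_of_new h1, sjSegment_of_side h2 h2'] at h
    exact absurd (newSegment_injective (s' := sideSlot θ s' h2 ⟨i, h2'⟩) hs h2' h).1.symm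
      (otherServer_ne _ _)
  · rw [sjSegment_of_new (s := s') (i := ⟨i, hs'⟩) h2, sjSegment_of_side h1 h1'] at h
    exact absurd (newSegment_injective (s := sideSlot θ s h1 ⟨i, h1'⟩) h1' hs' h).1
      (otherServer_ne _ _)
  · rw [sjSegment_of_side h1 h1', sjSegment_of_side h2 h2'] at h
    obtain ⟨ha, hb⟩ := newSegment_injective (s := sideSlot θ s h1 ⟨i, h1'⟩)
      (s' := sideSlot θ s' h2 ⟨i, h2'⟩) h1' h2' h
    exact side_injective (otherServer_injective _ ha) hb

/-- Privacy of the Sun–Jafar scheme: the law of the query to a server does not depend on the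
desired file. -/
lemma sjQueryLaw_map_eval {N K : ℕ} (θ θ' : Fin K) (n : Fin N) :
    (sjQueryLaw N K θ).map (fun q => q n) = (sjQueryLaw N K θ').map fun q => q n := by
  choose σ hσ using fun i => Equiv.Perm.exists_comp_eq (sjSegment_injective (N := N) θ n i)
    (sjSegment_injective θ' n i)
  -- Right multiplication by `σ` preserves the uniform law of `γ` and turns the query for `θ` into
  -- the query for `θ'`.
  let e : (Fin K → Equiv.Perm (Fin (N ^ K))) ≃ (Fin K → Equiv.Perm (Fin (N ^ K))) :=
    Equiv.mulRight σ
  unfold sjQueryLaw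
  rw [PMF.map_comp, PMF.map_comp, ← PMF.map_equiv_uniformOfFintype e, PMF.map_comp,
    PMF.map_equiv_uniformOfFintype e]
  congr 1
  funext γ s i
  simp only [Function.comp_apply, e, Equiv.coe_mulRight, Pi.mul_apply, Equiv.Perm.mul_apply]
  rw [← hσ i.1 ⟨s, i.2⟩]

/-- Decodability of the Sun–Jafar scheme, for files with segments in an abelian group. -/
lemma sj_decode {N K : ℕ} {B : Type*} [AddCommGroup B] (θ : Fin K)
    (γ : Fin K → Equiv.Perm (Fin (N ^ K))) (V V' : Fin K → Fin (N ^ K) → B)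
    (h : ∀ (n : Fin N) (s : SJSlot N K),
      ∑ i : {i : Fin K // i ∈ s.1.1}, V i.1 (γ i.1 (sjSegment θ n s i)) =
        ∑ i : {i : Fin K // i ∈ s.1.1}, V' i.1 (γ i.1 (sjSegment θ n s i))) :
    V θ = V' θ := by
  -- The answers are additive, so it suffices to treat the difference of the two file contents, for
  -- which all requested sums vanish.
  let U : Fin K → Fin (N ^ K) → B := fun i x => V i x - V' i x
  have hU : ∀ (n : Fin N) (s : SJSlot N K),
      ∑ i : {i : Fin K // i ∈ s.1.1}, U i.1 (γ i.1 (sjSegment θ n s i)) = 0 := fun n s => by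
    simp only [U, Finset.sum_sub_distrib, h, sub_self]
  suffices ∀ x, U θ (γ θ x) = 0 by
    funext x
    obtain ⟨y, rfl⟩ := (γ θ).surjective x
    exact sub_eq_zero.1 (this y)
  intro x
  obtain ⟨n, s, hθ, rfl⟩ := exists_newSegment_eq θ x
  have hns := hU n s
  rw [← Finset.add_sum_erase _ _ (Finset.mem_univ ⟨θ, hθ⟩),
    sjSegment_of_new (i := ⟨θ, hθ⟩) fun _ => rfl] at hns
  suffices hside : ∑ i ∈ Finset.univ.erase (⟨θ, hθ⟩ : {i : Fin K // i ∈ s.1.1}),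
      U i.1 (γ i.1 (sjSegment θ n s i)) = 0 by
    rwa [hside, add_zero] at hns
  by_cases hne : (s.1.1.erase θ).Nonempty
  -- The interference of the files other than `θ` is, term by term, the side sum at the other
  -- server, which is zero as well. There all segments are new, because the type no longer contains
  -- `θ`.
  · rw [← hU (otherServer n (sideLetter θ s hθ hne)) (sideSlot θ s hθ hne)]
    refine Finset.sum_bij' (fun i hi => ⟨i.1, Finset.mem_erase.2
        ⟨fun h => (Finset.mem_erase.1 hi).1 (Subtype.ext h), i.2⟩⟩)
      (fun i _ => ⟨i.1, Finset.mem_of_mem_erase i.2⟩) (fun _ _ => Finset.mem_univ _)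
      (fun i _ => Finset.mem_erase.2 ⟨fun h => (Finset.mem_erase.1 i.2).1
        (congrArg Subtype.val h), Finset.mem_univ _⟩) (fun _ _ => rfl) (fun _ _ => rfl) ?_
    intro i hi
    have hi' : i.1 ∈ s.1.1.erase θ := Finset.mem_erase.2
      ⟨fun h => (Finset.mem_erase.1 hi).1 (Subtype.ext h), i.2⟩
    rw [sjSegment_of_side hθ hi', sjSegment_of_new]
    exact fun h => absurd rfl (Finset.mem_erase.1 h).1
  · refine Finset.sum_eq_zero fun i hi => absurd ⟨i.1, Finset.mem_erase.2 ⟨fun h =>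
      (Finset.mem_erase.1 hi).1 (Subtype.ext h), i.2⟩⟩ hne

/-! ### Correctness of the time-sharing scheme -/

lemma superSegment_ext {N M s : ℕ} {A : Type*} (hs : s ≤ M) {w w' : Fin (N ^ M) → A}
    (h : superSegment hs w = superSegment hs w') : w = w' := by
  have hc : N ^ s * N ^ (M - s) = N ^ M := by rw [← pow_add, Nat.add_sub_cancel' hs]
  funext z
  obtain ⟨⟨x, y⟩, hxy⟩ := finProdFinEquiv.surjective (Fin.cast hc.symm z)
  have := congrFun (congrFun h x) y
  simpa [superSegment, hxy] using this

lemma mem_support_sjQueryLawOn {N M : ℕ} {S : Finset (Fin M)} {k : Fin M} {hk : k ∈ S}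
    {q : Fin N → WSJQuery N M} (hq : q ∈ (sjQueryLawOn N S k hk).support) :
    ∃ γ : Fin S.card → Equiv.Perm (Fin (N ^ S.card)), q = fun n => WSJQuery.sj S fun s i =>
      γ i.1 (sjSegment ((S.orderIsoOfFin rfl).symm ⟨k, hk⟩) n s i) := by
  simp only [sjQueryLawOn, sjQueryLaw, PMF.map_comp, PMF.mem_support_map_iff] at hq
  obtain ⟨γ, -, rfl⟩ := hq
  exact ⟨γ, rfl⟩

lemma sjQueryLawOn_decode {N M : ℕ} {A : Type*} [AddCommGroup A] {S : Finset (Fin M)} {k : Fin M}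
    {hk : k ∈ S} {q : Fin N → WSJQuery N M} (hq : q ∈ (sjQueryLawOn N S k hk).support)
    {W W' : Fin M → Fin (N ^ M) → A} (h : ∀ l, wsjAnswer W (q l) = wsjAnswer W' (q l)) :
    W k = W' k := by
  obtain ⟨γ, rfl⟩ := mem_support_sjQueryLawOn hq
  set θ := (S.orderIsoOfFin rfl).symm ⟨k, hk⟩ with hθ
  have hkθ : S.orderEmbOfFin rfl θ = k := by
    rw [← Finset.coe_orderIsoOfFin_apply, hθ, OrderIso.apply_symm_apply]
  have key := sj_decode θ γ
    (fun i => superSegment (card_finset_fin_le S) (W (S.orderEmbOfFin rfl i)))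
    (fun i => superSegment (card_finset_fin_le S) (W' (S.orderEmbOfFin rfl i))) (by
      intro n s
      funext y
      have hsy : ∑ i : {i : Fin S.card // i ∈ s.1.1}, superSegment (card_finset_fin_le S)
          (W (S.orderEmbOfFin rfl i.1)) (γ i.1 (sjSegment θ n s i)) y =
          ∑ i : {i : Fin S.card // i ∈ s.1.1}, superSegment (card_finset_fin_le S)
            (W' (S.orderEmbOfFin rfl i.1)) (γ i.1 (sjSegment θ n s i)) y :=
        congrFun (h n) (s, y)
      simpa only [Finset.sum_apply] using hsy)
  simp only [hkθ] at key
  exact superSegment_ext _ key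

lemma wsjQueryLawGiven_decode {N M : ℕ} [NeZero N] {A : Type*} [AddCommGroup A] {k m' : Fin M}
    {q : Fin N → WSJQuery N M} (hq : q ∈ (wsjQueryLawGiven N M k m').support)
    {W W' : Fin M → Fin (N ^ M) → A} (h : ∀ l, wsjAnswer W (q l) = wsjAnswer W' (q l)) :
    W k = W' k := by
  unfold wsjQueryLawGiven at hq
  split_ifs at hq
  · rw [PMF.mem_support_map_iff] at hq
    obtain ⟨s, -, rfl⟩ := hq
    have hs := h s
    beta_reduce at hs
    rw [if_pos rfl] at hs
    exact hs
  · rw [PMF.mem_support_bind_iff] at hq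
    obtain ⟨J, -, hq⟩ := hq
    exact sjQueryLawOn_decode hq h

/-- Equal transcripts have equal queries, so vanishing entropy reduces to deterministic decoding for
each possible query tuple. -/
lemma IRScheme.correct_of_decode {N M L : ℕ} {A : Type*} [Fintype A] [Nonempty A]
    (C : IRScheme N M L A)
    (h : ∀ (m : Fin M), ∀ q ∈ (C.queryLaw m).support, ∀ W W' : Fin M → Fin L → A,
      (∀ l, C.answer l (q l) W = C.answer l (q l) W') → W m = W' m) : C.Correct := by
  intro m
  apply condEntropy_eq_zero
  rintro ⟨q, W⟩ hq ⟨q', W'⟩ - heq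
  simp only [IRScheme.transcript, Sigma.mk.injEq] at heq
  obtain ⟨rfl, heq⟩ := heq
  simp only [IRScheme.jointLaw, PMF.mem_support_bind_iff, PMF.mem_support_map_iff] at hq
  obtain ⟨q₀, hq₀, W₀, -, hW⟩ := hq
  cases hW
  exact h m _ hq₀ _ _ fun l => congrFun (eq_of_heq heq) l

lemma WSJ_correct (N M : ℕ) [NeZero N] (A : Type*) [AddCommGroup A] [Fintype A]
    (p : PMF (Fin M)) : (WSJ N M A p).Correct := by
  apply IRScheme.correct_of_decode
  intro m q hq W W' h
  obtain ⟨m', -, hq⟩ := (PMF.mem_support_bind_iff _ _ _).1 hq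
  exact wsjQueryLawGiven_decode hq h

/-! ### Time sharing between clean download and the full Sun–Jafar scheme -/

/-- The law of a random variable that is `a` with probability `t` and `b` otherwise. -/
noncomputable def twoPointLaw {α : Type*} (t : ℝ) (h0 : 0 ≤ t) (h1 : t ≤ 1) (a b : α) : PMF α :=
  (PMF.ofFintype (fun x : Bool => ENNReal.ofReal (if x then t else 1 - t)) (by
    rw [Fintype.sum_bool, ← ENNReal.ofReal_add] <;> simp [h0, h1])).map
    fun x => if x then a else b

lemma twoPointLaw_support {α : Type*} {t : ℝ} {h0 : 0 ≤ t} {h1 : t ≤ 1} {a b c : α}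
    (ha : c ≠ a) (hb : c ≠ b) : twoPointLaw t h0 h1 a b c = 0 := by
  rw [PMF.apply_eq_zero_iff, twoPointLaw, PMF.mem_support_map_iff]
  rintro ⟨x, -, rfl⟩
  cases x <;> simp_all

lemma twoPointLaw_bind_toReal {α β : Type*} {t : ℝ} (h0 : 0 ≤ t) (h1 : t ≤ 1) (a b : α)
    (f : α → PMF β) (c : β) : ((twoPointLaw t h0 h1 a b).bind f c).toReal =
      t * (f a c).toReal + (1 - t) * (f b c).toReal := by
  rw [twoPointLaw, PMF.bind_map, PMF.bind_apply, tsum_fintype, Fintype.sum_bool,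
    ENNReal.toReal_add
    (ENNReal.mul_ne_top (PMF.apply_ne_top _ _) (PMF.apply_ne_top _ _))
    (ENNReal.mul_ne_top (PMF.apply_ne_top _ _) (PMF.apply_ne_top _ _))]
  simp [h0, h1]

lemma wsjQueryLawGiven_last {N M : ℕ} [NeZero N] (k m' : Fin M) (h : m'.val = M - 1)
    (h0 : m'.val ≠ 0) :
    wsjQueryLawGiven N M k m' = sjQueryLawOn N Finset.univ k (Finset.mem_univ k) := by
  -- The query type depends on `S`, so the set is generalized before it is replaced by
  -- `Finset.univ`.
  have hcongr : ∀ (S : Finset (Fin M)) (hk : k ∈ S), S = Finset.univ →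
      sjQueryLawOn N S k hk = sjQueryLawOn N Finset.univ k (Finset.mem_univ k) := by
    rintro S hk rfl
    rfl
  rw [wsjQueryLawGiven, if_neg h0]
  refine PMF.bind_eq_of_const _ _ _ fun J hJ => hcongr _ _ ?_
  rw [PMF.mem_support_uniformOfFinset_iff, Finset.mem_powersetCard] at hJ
  -- There is only one way to choose `M - 1` files different from `k`.
  have hJ' : J = Finset.univ.erase k := Finset.eq_of_subset_of_card_le hJ.1 (by
    rw [Finset.card_erase_of_mem (Finset.mem_univ k), Finset.card_fin, hJ.2, h])
  rw [hJ', Finset.insert_erase (Finset.mem_univ k)]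

/-- The law of the query seen by server `l` in clean download of file `k`. -/
noncomputable def cleanServerLaw (N M : ℕ) [NeZero N] (k : Fin M) (l : Fin N) :
    PMF (WSJQuery N M) :=
  (PMF.uniformOfFintype (Fin N)).map fun s => if l = s then WSJQuery.file k else WSJQuery.null

lemma cleanServerLaw_file {N M : ℕ} [NeZero N] (k k' : Fin M) (l : Fin N) :
    (cleanServerLaw N M k l (.file k')).toReal = if k' = k then 1 / (N : ℝ) else 0 := by
  classical
  rw [cleanServerLaw, PMF.map_apply, tsum_eq_single l]
  · by_cases h : k' = k <;> simp [h]
  · intro s hs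
    simp [hs.symm]

lemma cleanServerLaw_null {N M : ℕ} [NeZero N] (k : Fin M) (l : Fin N) :
    (cleanServerLaw N M k l .null).toReal = 1 - 1 / (N : ℝ) := by
  classical
  have hN : (N : ℝ) ≠ 0 := Nat.cast_ne_zero.2 (NeZero.ne N)
  rw [cleanServerLaw, PMF.map_apply, tsum_fintype, ENNReal.toReal_sum]
  · have : ∀ s : Fin N, (if (WSJQuery.null : WSJQuery N M) = (if l = s then WSJQuery.file k else WSJQuery.null)
        then PMF.uniformOfFintype (Fin N) s else 0).toReal =
        1 / (N : ℝ) - if l = s then 1 / (N : ℝ) else 0 := fun s => by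
      by_cases h : l = s <;> simp [h]
    rw [Finset.sum_congr rfl fun s _ => this s, Finset.sum_sub_distrib]
    simp [hN]
  · intro s _
    exact ne_of_lt ((by split_ifs <;> simp : _ ≤ PMF.uniformOfFintype (Fin N) s).trans_lt
      (PMF.apply_lt_top _ _))

lemma cleanServerLaw_sj {N M : ℕ} [NeZero N] (k : Fin M) (l : Fin N) (S : Finset (Fin M))
    (r : SJQuery N S.card) : cleanServerLaw N M k l (.sj S r) = 0 := by
  rw [PMF.apply_eq_zero_iff, cleanServerLaw, PMF.mem_support_map_iff]
  rintro ⟨s, -, hs⟩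
  split_ifs at hs

/-- The law of the query seen by server `l` in the Sun–Jafar scheme on all files. -/
noncomputable def sjServerLaw (N M : ℕ) (k : Fin M) (l : Fin N) : PMF (WSJQuery N M) :=
  (sjQueryLawOn N Finset.univ k (Finset.mem_univ k)).map fun q => q l

/-- The announced file set is `Finset.univ` for every desired file, so it reveals nothing and
privacy of the inner scheme applies. -/
lemma sjServerLaw_eq {N M : ℕ} (k k' : Fin M) (l : Fin N) :
    sjServerLaw N M k l = sjServerLaw N M k' l := by
  have h : ∀ k : Fin M, sjServerLaw N M k l = ((sjQueryLaw N _
      (((Finset.univ : Finset (Fin M)).orderIsoOfFin rfl).symm ⟨k, Finset.mem_univ k⟩)).map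
        fun q => q l).map (WSJQuery.sj Finset.univ) := fun k => by
    rw [sjServerLaw, sjQueryLawOn, PMF.map_comp, PMF.map_comp]
    rfl
  rw [h k, h k', sjQueryLaw_map_eval]

lemma sjServerLaw_apply_eq_zero {N M : ℕ} {k : Fin M} {l : Fin N} {q : WSJQuery N M}
    (hq : ∀ S r, q ≠ .sj S r) : sjServerLaw N M k l q = 0 := by
  rw [PMF.apply_eq_zero_iff, sjServerLaw, PMF.mem_support_map_iff]
  rintro ⟨q', hq', rfl⟩
  obtain ⟨γ, rfl⟩ := mem_support_sjQueryLawOn hq'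
  exact hq _ _ rfl

lemma WSJQuery.exists_sum_eq (N M : ℕ) :
    ∃ (ι : Type) (_ : Fintype ι) (g : ι → WSJQuery N M), (∀ x, ∃ S r, g x = .sj S r) ∧
      ∀ F : WSJQuery N M → ℝ, ∑ q, F q = F .null + ∑ k, F (.file k) + ∑ x, F (g x) := by
  classical
  let e : Unit ⊕ Fin M ⊕ (Σ S : Finset (Fin M), SJQuery N S.card) ≃ WSJQuery N M :=
    { toFun := fun x => match x with
        | .inl _ => .null
        | .inr (.inl k) => .file k
        | .inr (.inr y) => .sj y.1 y.2
      invFun := fun q => match q with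
        | .null => .inl ()
        | .file k => .inr (.inl k)
        | .sj S r => .inr (.inr ⟨S, r⟩)
      left_inv := by rintro (_ | _ | _) <;> rfl
      right_inv := by rintro (_ | _ | _) <;> rfl }
  refine ⟨Σ S : Finset (Fin M), SJQuery N S.card, inferInstance, fun y => .sj y.1 y.2,
    fun y => ⟨y.1, y.2, rfl⟩, fun F => ?_⟩
  rw [← e.sum_comp, Fintype.sum_sum_type, Fintype.sum_sum_type, add_assoc]
  simp [e]

lemma sum_iSup_timeSharing {N M : ℕ} [NeZero N] (hM : 0 < M) {t : ℝ} (h0 : 0 ≤ t) (l : Fin N)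
    (P : Fin M → PMF (WSJQuery N M))
    (hP : ∀ k q, (P k q).toReal =
      t * (cleanServerLaw N M k l q).toReal + (1 - t) * (sjServerLaw N M k l q).toReal) :
    ∑ q, ⨆ m, (P m q).toReal = 1 + t * ((M : ℝ) - 1) / N := by
  have : Nonempty (Fin M) := ⟨⟨0, hM⟩⟩
  let m₀ : Fin M := ⟨0, hM⟩
  obtain ⟨ι, _, g, hg, hsum⟩ := WSJQuery.exists_sum_eq N M
  have hnull : ∀ k, (P k .null).toReal = t * (1 - 1 / (N : ℝ)) := fun k => by
    rw [hP, cleanServerLaw_null, sjServerLaw_apply_eq_zero (by simp)]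
    simp
  have hfile : ∀ k k', (P k (.file k')).toReal = if k' = k then t / N else 0 := fun k k' => by
    rw [hP, cleanServerLaw_file, sjServerLaw_apply_eq_zero (by simp)]
    split_ifs <;> simp [div_eq_mul_inv]
  have hsj : ∀ k x, (P k (g x)).toReal = (P m₀ (g x)).toReal := fun k x => by
    obtain ⟨S, r, h⟩ := hg x
    rw [hP, hP, h, cleanServerLaw_sj, cleanServerLaw_sj, sjServerLaw_eq k m₀]
  -- The total mass of one law supplies the Sun–Jafar contribution without evaluating it. This total
  -- contains `t / N` once, the sum of maxima contains it `M` times.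
  have htot := (P m₀).sum_toReal
  rw [hsum, hnull] at htot
  simp only [hfile, Finset.sum_ite_eq', Finset.mem_univ, if_true] at htot
  have hsup : ∀ k' : Fin M, ⨆ k, (P k (.file k')).toReal = t / N := fun k' => by
    apply le_antisymm
    · refine ciSup_le fun k => ?_
      rw [hfile]
      split_ifs
      · rfl
      · positivity
    · refine le_ciSup_of_le (Set.finite_range _).bddAbove k' ?_
      rw [hfile, if_pos rfl]
  rw [hsum]
  simp only [hnull, hsup, hsj, ciSup_const, Finset.sum_const, Finset.card_univ, Fintype.card_fin,
    nsmul_eq_mul]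
  linear_combination htot

/-! ### Download of the Sun–Jafar scheme -/

open Polynomial in
-- After multiplication by `x`, both sides become `(x + 1) ^ K - 1`, by the binomial and geometric
-- sums. The factor is cancelled in `ℤ[X]` before evaluation, so that `x = 0` is covered; this is
-- the case `N = 1` below.
lemma Finset.sum_nonempty_pow_card_sub_one {R : Type*} [CommRing R] (K : ℕ) (x : R) :
    ∑ T : {T : Finset (Fin K) // T.Nonempty}, x ^ (T.1.card - 1) =
      ∑ i ∈ Finset.range K, (x + 1) ^ i := by
  classical
  have h : (∑ T : {T : Finset (Fin K) // T.Nonempty}, X ^ (T.1.card - 1) : ℤ[X]) =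
      ∑ i ∈ Finset.range K, (X + 1) ^ i := by
    apply mul_left_cancel₀ (X_ne_zero (R := ℤ))
    have h1 := mul_geom_sum (X + 1 : ℤ[X]) K
    rw [add_sub_cancel_right] at h1
    have h2 := Fintype.sum_pow_mul_eq_add_pow (Fin K) (X : ℤ[X]) 1
    simp only [one_pow, mul_one, Fintype.card_fin] at h2
    rw [h1, ← h2, ← Finset.add_sum_erase _ (fun T : Finset (Fin K) => (X : ℤ[X]) ^ T.card)
      (Finset.mem_univ ∅), Finset.card_empty, pow_zero, add_sub_cancel_left, Finset.mul_sum, ← Finset.sum_subtype (s := Finset.univ.erase ∅)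
      (f := fun T : Finset (Fin K) => (X : ℤ[X]) * X ^ (T.card - 1))
      (fun T => by simp [Finset.nonempty_iff_ne_empty])]
    refine Finset.sum_congr rfl fun T hT => ?_
    have : T.card ≠ 0 := by simpa using hT
    rw [← pow_succ', Nat.sub_add_cancel (Nat.one_le_iff_ne_zero.2 this)]
  simpa only [map_sum, map_pow, map_add, map_one, aeval_X] using congrArg (aeval x) h

lemma card_SJSlot (N K : ℕ) (hN : 1 ≤ N) :
    (Fintype.card (SJSlot N K) : ℝ) = ∑ i ∈ Finset.range K, (N : ℝ) ^ i := by
  rw [Fintype.card_sigma]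
  have := Finset.sum_nonempty_pow_card_sub_one K ((N : ℝ) - 1)
  rw [sub_add_cancel] at this
  rw [← this]
  push_cast
  refine Finset.sum_congr rfl fun T _ => ?_
  rw [Fintype.card_fun, Fintype.card_fin, Fintype.card_fin, Nat.cast_pow, Nat.cast_sub hN,
    Nat.cast_one]

lemma mul_card_SJSlot (N K : ℕ) (hN : 1 ≤ N) (hK : 1 ≤ K) :
    (N : ℝ) * Fintype.card (SJSlot N K) =
      (N : ℝ) ^ K * (1 + ∑ i ∈ Finset.Icc 1 (K - 1), 1 / (N : ℝ) ^ i) := by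
  have hN0 : (N : ℝ) ≠ 0 := by positivity
  have h1 : 1 + ∑ i ∈ Finset.Icc 1 (K - 1), 1 / (N : ℝ) ^ i =
      ∑ i ∈ Finset.range K, 1 / (N : ℝ) ^ i := by
    obtain ⟨K, rfl⟩ := Nat.exists_eq_add_of_le' hK
    rw [Finset.sum_range_succ', Nat.add_sub_cancel, ← Finset.Ico_add_one_right_eq_Icc,
      Finset.sum_Ico_eq_sum_range]
    simp [add_comm]
  rw [card_SJSlot N K hN, h1, ← Finset.sum_range_reflect (fun i => 1 / (N : ℝ) ^ i),
    Finset.mul_sum, Finset.mul_sum]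
  refine Finset.sum_congr rfl fun i hi => ?_
  have : K = (K - 1 - i) + (i + 1) := by
    have := Finset.mem_range.1 hi
    omega
  rw [mul_one_div, eq_div_iff (pow_ne_zero _ hN0), ← pow_succ', ← pow_add]
  congr 1
  omega

lemma card_WSJAnswerIndex_sj {N M : ℕ} (S : Finset (Fin M)) (r : SJQuery N S.card) :
    Fintype.card (WSJAnswerIndex (WSJQuery.sj S r)) =
      Fintype.card (SJSlot N S.card) * N ^ (M - S.card) := by
  change Fintype.card (SJSlot N S.card × Fin (N ^ (M - S.card))) = _
  rw [Fintype.card_prod, Fintype.card_fin]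

/-- The number of sums depends only on `S`, not on the permutations, and the super-segment length `N
^ (M - |S|)` scales `N ^ |S|` up to the file length. -/
lemma sjQueryLawOn_download {N M : ℕ} [NeZero N] (A : Type*) [AddCommGroup A] [Fintype A]
    (p : PMF (Fin M)) {S : Finset (Fin M)} {k : Fin M} {hk : k ∈ S} {q : Fin N → WSJQuery N M}
    (hq : q ∈ (sjQueryLawOn N S k hk).support) :
    (WSJ N M A p).download q = (N : ℝ) ^ M * Real.logb 2 (Fintype.card A) *
      (1 + ∑ i ∈ Finset.Icc 1 (S.card - 1), 1 / (N : ℝ) ^ i) := by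
  obtain ⟨γ, rfl⟩ := mem_support_sjQueryLawOn hq
  have hS : N ^ M = N ^ S.card * N ^ (M - S.card) := by
    rw [← pow_add, Nat.add_sub_cancel' (card_finset_fin_le S)]
  have hc := fun l => card_WSJAnswerIndex_sj S fun s i =>
      γ i.1 (sjSegment ((S.orderIsoOfFin rfl).symm ⟨k, hk⟩) l s i)
  change ∑ l : Fin N, (Fintype.card (WSJAnswerIndex (WSJQuery.sj S fun s i =>
      γ i.1 (sjSegment ((S.orderIsoOfFin rfl).symm ⟨k, hk⟩) l s i))) : ℝ) * _ = _
  simp only [hc, Finset.sum_const, Finset.card_univ, Fintype.card_fin, nsmul_eq_mul,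
    Nat.cast_mul]
  have h := mul_card_SJSlot N S.card (NeZero.one_le) (Finset.card_pos.2 ⟨k, hk⟩)
  have hS' : (N : ℝ) ^ M = (N : ℝ) ^ S.card * (N : ℝ) ^ (M - S.card) := by exact_mod_cast hS
  rw [hS', Nat.cast_pow]
  linear_combination (N : ℝ) ^ (M - S.card) * Real.logb 2 (Fintype.card A) * h

lemma clean_download {N M : ℕ} [NeZero N] (A : Type*) [AddCommGroup A] [Fintype A]
    (p : PMF (Fin M)) {k : Fin M} (s : Fin N) :
    (WSJ N M A p).download (fun l => if l = s then WSJQuery.file k else WSJQuery.null) =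
      (N : ℝ) ^ M * Real.logb 2 (Fintype.card A) := by
  have hc : ∀ l, Fintype.card (WSJAnswerIndex (N := N) (M := M)
      (if l = s then WSJQuery.file k else WSJQuery.null)) = if l = s then N ^ M else 0 := fun l => by
    split_ifs
    · exact Fintype.card_fin _
    · exact Fintype.card_empty
  change ∑ l : Fin N, (Fintype.card (WSJAnswerIndex (N := N) (M := M)
      (if l = s then WSJQuery.file k else WSJQuery.null)) : ℝ) * _ = _
  simp [hc]

/-! ### Leakage and rate of the time-sharing scheme -/

lemma WSJ_queryLaw_toReal {N M : ℕ} [NeZero N] {A : Type*} [AddCommGroup A] {t : ℝ} (h0 : 0 ≤ t)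
    (h1 : t ≤ 1) {a b : Fin M} (ha : a.val = 0) (hb : b.val = M - 1) (hM : 2 ≤ M) (k : Fin M)
    (q : Fin N → WSJQuery N M) :
    ((WSJ N M A (twoPointLaw t h0 h1 a b)).queryLaw k q).toReal =
      t * ((PMF.uniformOfFintype (Fin N)).map
        (fun s l => if l = s then WSJQuery.file k else WSJQuery.null) q).toReal +
      (1 - t) * (sjQueryLawOn N Finset.univ k (Finset.mem_univ k) q).toReal := by
  have := twoPointLaw_bind_toReal h0 h1 a b (wsjQueryLawGiven N M k) q
  rwa [wsjQueryLawGiven_last k b hb (by omega), wsjQueryLawGiven, if_pos ha] at this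

lemma WSJ_serverLaw_toReal {N M : ℕ} [NeZero N] {A : Type*} [AddCommGroup A] {t : ℝ} (h0 : 0 ≤ t)
    (h1 : t ≤ 1) {a b : Fin M} (ha : a.val = 0) (hb : b.val = M - 1) (hM : 2 ≤ M) (k : Fin M)
    (l : Fin N) (q : WSJQuery N M) :
    ((WSJ N M A (twoPointLaw t h0 h1 a b)).serverLaw l k q).toReal =
      t * (cleanServerLaw N M k l q).toReal + (1 - t) * (sjServerLaw N M k l q).toReal := by
  have := twoPointLaw_bind_toReal h0 h1 a b
    (fun m' => (wsjQueryLawGiven N M k m').map fun q => q l) q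
  rw [wsjQueryLawGiven_last k b hb (by omega), wsjQueryLawGiven, if_pos ha, PMF.map_comp] at this
  rw [← PMF.map_bind] at this
  exact this

lemma WSJ_maxLeakage {N M : ℕ} [NeZero N] {A : Type*} [AddCommGroup A] {t : ℝ} (h0 : 0 ≤ t)
    (h1 : t ≤ 1) {a b : Fin M} (ha : a.val = 0) (hb : b.val = M - 1) (hM : 2 ≤ M) :
    (WSJ N M A (twoPointLaw t h0 h1 a b)).maxLeakage =
      Real.logb 2 (1 + t * ((M : ℝ) - 1) / N) := by
  have : ∀ l : Fin N, _ := fun l => sum_iSup_timeSharing (by omega) h0 l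
    ((WSJ N M A (twoPointLaw t h0 h1 a b)).serverLaw l)
    fun k q => WSJ_serverLaw_toReal h0 h1 ha hb hM k l q
  refine (iSup_congr fun l => congrArg (Real.logb 2) (this l)).trans ?_
  exact ciSup_const

lemma WSJ_rate {N M : ℕ} [NeZero N] {A : Type*} [AddCommGroup A] [Fintype A] [Nontrivial A] {t : ℝ}
    (h0 : 0 ≤ t) (h1 : t ≤ 1) {a b : Fin M} (ha : a.val = 0) (hb : b.val = M - 1) (hM : 2 ≤ M) :
    (WSJ N M A (twoPointLaw t h0 h1 a b)).rate =
      (1 + (1 - t) * ∑ i ∈ Finset.Icc 1 (M - 1), 1 / (N : ℝ) ^ i)⁻¹ := by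
  set B : ℝ := (N : ℝ) ^ M * Real.logb 2 (Fintype.card A) with hB
  set G : ℝ := ∑ i ∈ Finset.Icc 1 (M - 1), 1 / (N : ℝ) ^ i
  have hB0 : B ≠ 0 := mul_ne_zero (pow_ne_zero _ (Nat.cast_ne_zero.2 (NeZero.ne N)))
    (Real.logb_pos one_lt_two (by exact_mod_cast Fintype.one_lt_card)).ne'
  let C := WSJ N M A (twoPointLaw t h0 h1 a b)
  have hk : ∀ k : Fin M, ∑ q : (∀ l, C.Query l), (C.queryLaw k q).toReal * C.download q =
      t * B + (1 - t) * (B * (1 + G)) := fun k =>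
    PMF.sum_toReal_mul_of_mixture (fun q => WSJ_queryLaw_toReal h0 h1 ha hb hM k q)
      (fun q hq => by
        obtain ⟨s, -, rfl⟩ := (PMF.mem_support_map_iff _ _ _).1 hq
        exact clean_download A _ s)
      (fun q hq => (sjQueryLawOn_download A _ hq).trans (by rw [Finset.card_fin]))
  have hM0 : (M : ℝ) ≠ 0 := by positivity
  have hD : C.expectedDownload = B * (1 + (1 - t) * G) := by
    unfold IRScheme.expectedDownload
    simp only [hk, Finset.sum_const, Finset.card_univ, Fintype.card_fin, nsmul_eq_mul]
    field_simp
    ring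
  change C.rate = _
  rw [IRScheme.rate, hD, Nat.cast_pow, ← hB, div_mul_eq_div_div, div_self hB0, one_div]

theorem theorem2 (N M : ℕ) [NeZero N] (hM : 2 ≤ M)
    (A : Type*) [AddCommGroup A] [Fintype A] [Nontrivial A] (ρ : ℝ) (hρ : 0 ≤ ρ) :
    ∃ p : PMF (Fin M),
      (∀ m' : Fin M, m'.val ≠ 0 → m'.val ≠ M - 1 → p m' = 0) ∧
      (WSJ N M A p).Correct ∧
      (WSJ N M A p).maxLeakage = min ρ (Real.logb 2 (1 + ((M : ℝ) - 1) / N)) ∧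
      (WSJ N M A p).rate =
        (1 + max 0 (1 - N * ((2 : ℝ) ^ ρ - 1) / ((M : ℝ) - 1)) *
          ∑ i ∈ Finset.Icc 1 (M - 1), 1 / (N : ℝ) ^ i)⁻¹ := by
  have hN : (0 : ℝ) < N := Nat.cast_pos.2 (NeZero.pos N)
  have hM1 : (0 : ℝ) < (M : ℝ) - 1 := by
    have : (2 : ℝ) ≤ M := by exact_mod_cast hM
    linarith
  have hpow : (1 : ℝ) ≤ 2 ^ ρ := Real.one_le_rpow one_le_two hρ
  -- `u` is the solution of `1 + u (M - 1) / N = 2 ^ ρ`. For `u ≥ 1` the choice `min 1 u` is pure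
  -- clean download, whose leakage is the second term of the minimum.
  set u : ℝ := N * ((2 : ℝ) ^ ρ - 1) / ((M : ℝ) - 1) with hu
  have hu0 : 0 ≤ u := div_nonneg (mul_nonneg hN.le (by linarith)) hM1.le
  refine ⟨twoPointLaw (min 1 u) (le_min zero_le_one hu0) (min_le_left _ _) ⟨0, by omega⟩
    ⟨M - 1, by omega⟩, ?_, WSJ_correct N M A _, ?_, ?_⟩
  · intro m' h h'
    exact twoPointLaw_support (fun e => h (congrArg Fin.val e)) fun e => h' (congrArg Fin.val e)
  · rw [WSJ_maxLeakage _ _ rfl rfl hM]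
    have hρu : ρ = Real.logb 2 (1 + u * ((M : ℝ) - 1) / N) := by
      rw [hu, div_mul_cancel₀ _ hM1.ne', mul_div_cancel_left₀ _ hN.ne', add_sub_cancel,
        Real.logb_rpow two_pos (by norm_num)]
    rcases le_total 1 u with h | h
    · rw [min_eq_left h, one_mul, min_eq_right]
      rw [hρu]
      refine Real.logb_le_logb_of_le one_lt_two (by positivity) ?_
      gcongr
      exact le_mul_of_one_le_left hM1.le h
    · rw [min_eq_right h, ← hρu, min_eq_left]
      rw [hρu]
      refine Real.logb_le_logb_of_le one_lt_two (by positivity) ?_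
      gcongr
      exact mul_le_of_le_one_left hM1.le h
  · rw [WSJ_rate _ _ rfl rfl hM]
    -- What remains is `1 - min 1 u = max 0 (1 - u)`.
    congr 3
    rcases le_total 1 u with h | h
    · rw [min_eq_left h, max_eq_left (by linarith), sub_self]
    · rw [min_eq_right h, max_eq_right (by linarith)]
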